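/- Let $n,d,m,c\ge 1$ be integers, let $\gamma:\mathbb{R}\to\mathbb{R}$ be $G_\gamma$-Lipschitz, let $x_1,\dots,x_n\in\mathbb{R}^d$, let $W^{(0)}\in\mathbb{R}^{m\times d}$ have rows $w_1^{(0)},\dots,w_m^{(0)}$, and let $R_W,R_V\ge 0$. For $W\in\mathbb{R}^{m\times d}$ with rows $w_1,\dots,w_m$ and $V=(v_{kj})\in\mathbb{R}^{c\times m}$ put $\Psi_{W,V}(x)=V\big(\gamma(w_1^\top x),\dots,\gamma(w_m^\top x)\big)^\top\in\mathbb{R}^c$, and let $$\mathcal{G}=\big\{\Psi_{W,V}:\ \|W-W^{(0)}\|_F\le R_W,\ \|V\|_F\le R_V\big\}.$$ Define the initialization-dependent path-norm $\kappa(W,V)=\sum_{j=1}^m\sum_{k=1}^c|v_{kj}|\,\|w_j-w_j^{(0)}\|_2$, let $\sup\kappa$ denote its supremum over all $(W,V)$ with $\|W-W^{(0)}\|_F\le R_W$ and $\|V\|_F\le R_V$, and define the vector-valued empirical Rademacher complexity $$\mathfrak{R}_S(\mathcal{G})=\frac1n\,\mathbb{E}_\sigma\sup_{g\in\mathcal{G}}\sum_{i=1}^n\sum_{k=1}^c\sigma_{ik}\,g_k(x_i),$$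 where the $\sigma_{ik}$ are independent and uniform on $\{-1,1\}$. Let $$c_m=2\sqrt2\Big(1+\frac{1}{2\log(2mc)}\Big)\log^{1/2}\Big(2mc\Big\lceil\log_2\frac{2R_WR_V\sqrt{cm}}{\sup\kappa}\Big\rceil\Big)$$ (if $R_WR_V=0$ then $\sup\kappa=0$ and the products of $c_m$ with $\sup\kappa$ and with $R_WR_V$ below are read as $0$). Then all the suprema above are finite, $$\mathfrak{R}_S(\mathcal{G})\le\frac{R_V}{n}\Big(c\sum_{j=1}^m\sum_{i=1}^n\gamma^2(x_i^\top w_j^{(0)})\Big)^{1/2}+G_\gamma\,\sup\kappa\,\Big(\frac{2+\sqrt5}{n}\Big(\sum_{i=1}^n\|x_i\|_2^2\Big)^{1/2}+\frac{c_m}{n}\Big\|\sum_{i=1}^nx_ix_i^\top\Big\|_\sigma^{1/2}\Big),$$ and $$\mathfrak{R}_S(\mathcal{G})\le\frac{R_V}{n}\Big(c\sum_{j=1}^m\sum_{i=1}^n\gamma^2(x_i^\top w_j^{(0)})\Big)^{1/2}+G_\gamma\sqrt c\,R_WR_V\Big(\frac{2+\sqrt5}{n}\Big(\sum_{i=1}^n\|x_i\|_2^2\Big)^{1/2}+\frac{c_m}{n}\Big\|\sum_{i=1}^nx_ix_i^\top\Big\|_\sigma^{1/2}\Big).$$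 Here $\|\cdot\|_F$ is the Frobenius norm and $\|\cdot\|_\sigma$ the spectral norm. -/

import Mathlib

open scoped Matrix NNReal BigOperators

namespace ShallowNet

noncomputable section

/-- Frobenius norm of a real matrix. -/
def frobNorm {p q : ℕ} (A : Matrix (Fin p) (Fin q) ℝ) : ℝ :=
  √(∑ i, ∑ j, A i j ^ 2)

/-- Spectral norm of a real square matrix: the operator norm for the Euclidean norm. -/
def specNorm {d : ℕ} (A : Matrix (Fin d) (Fin d) ℝ) : ℝ :=
  ‖Matrix.toEuclideanCLM (n := Fin d) (𝕜 := ℝ) A‖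

/-- The one-hidden-layer network `x ↦ V γ(W x)`, with `γ` applied entrywise; the rows of `W` are
the hidden weight vectors. -/
def net {d m c : ℕ} (γ : ℝ → ℝ) (W : Matrix (Fin m) (Fin d) ℝ) (V : Matrix (Fin c) (Fin m) ℝ)
    (x : EuclideanSpace ℝ (Fin d)) : Fin c → ℝ :=
  V *ᵥ fun j => γ (W j ⬝ᵥ x.ofLp)

/-- Hidden weights within Frobenius distance `RW` of the initialization `W₀`. -/
def hiddenBall {d m : ℕ} (W₀ : Matrix (Fin m) (Fin d) ℝ) (RW : ℝ) :
    Set (Matrix (Fin m) (Fin d) ℝ) :=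
  {W | frobNorm (W - W₀) ≤ RW}

/-- Top-layer weights of Frobenius norm at most `RV`. -/
def topBall (c m : ℕ) (RV : ℝ) : Set (Matrix (Fin c) (Fin m) ℝ) :=
  {V | frobNorm V ≤ RV}

/-- The hypothesis space of shallow networks. -/
def hypothesisSpace {d m : ℕ} (c : ℕ) (γ : ℝ → ℝ) (W₀ : Matrix (Fin m) (Fin d) ℝ) (RW RV : ℝ) :
    Set (EuclideanSpace ℝ (Fin d) → Fin c → ℝ) :=
  {g | ∃ W ∈ hiddenBall W₀ RW, ∃ V ∈ topBall c m RV, g = net γ W V}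

/-- The initialization-dependent path-norm `∑ⱼ ∑ₖ |vₖⱼ| ‖wⱼ - wⱼ⁽⁰⁾‖₂`. -/
def pathNorm {d m c : ℕ} (W₀ W : Matrix (Fin m) (Fin d) ℝ) (V : Matrix (Fin c) (Fin m) ℝ) : ℝ :=
  ∑ j, ∑ k, |V k j| * ‖WithLp.toLp 2 (W j - W₀ j)‖

/-- The values taken by the path-norm over all admissible pairs of weight matrices. -/
def pathNormValues {d m : ℕ} (c : ℕ) (W₀ : Matrix (Fin m) (Fin d) ℝ) (RW RV : ℝ) : Set ℝ :=
  {t | ∃ W ∈ hiddenBall W₀ RW, ∃ V ∈ topBall c m RV, t = pathNorm W₀ W V}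

/-- The supremum of the path-norm over all admissible pairs of weight matrices. -/
def supPathNorm {d m : ℕ} (c : ℕ) (W₀ : Matrix (Fin m) (Fin d) ℝ) (RW RV : ℝ) : ℝ :=
  sSup (pathNormValues c W₀ RW RV)

/-- For fixed signs `σ`, the values of `∑ᵢ ∑ₖ σᵢₖ gₖ(zᵢ)` over `g` in the class `F`. -/
def signedSums {Z : Type*} {n c : ℕ} (F : Set (Z → Fin c → ℝ)) (z : Fin n → Z)
    (σ : Fin n → Fin c → ℤˣ) : Set ℝ :=
  {t | ∃ g ∈ F, t = ∑ i, ∑ k, ((σ i k : ℤ) : ℝ) * g (z i) k}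

/-- Vector-valued empirical Rademacher complexity of the class `F` on the sample `z`.  Independent
Rademacher variables `σᵢₖ` are jointly uniform on the `2 ^ (n * c)` arrays of signs, so the
expectation is the average over all arrays. -/
def rademacher {Z : Type*} {n c : ℕ} (F : Set (Z → Fin c → ℝ)) (z : Fin n → Z) : ℝ :=
  1 / (n : ℝ) * ((∑ σ : Fin n → Fin c → ℤˣ, sSup (signedSums F z σ)) / 2 ^ (n * c))

/-- The factor `c_m`, as a function of the supremum `κ` of the path-norm. -/
def widthFactor (m c : ℕ) (RW RV κ : ℝ) : ℝ :=
  2 * √2 * (1 + 1 / (2 * Real.log (2 * m * c))) *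
    √(Real.log (2 * m * c * (⌈Real.logb 2 (2 * RW * RV * √(c * m) / κ)⌉ : ℝ)))

end

end ShallowNet

namespace ShallowNet

/-! ### Averages over signs -/

/-! Writing `γ(wⱼ·x)` as its value at initialization plus an increment splits a signed sum in two.
The initial part is linear in `V`; Cauchy–Schwarz and orthogonality of the signs give the first term
of the bound.

The increments are `G`-Lipschitz in `wⱼ - wⱼ⁽⁰⁾` and vanish at `0`. Each neuron is localized at a
dyadic radius `RW / 2 ^ l`, `l < K`, comparable to its own displacement (`exists_dyadic_scale`). Its
contribution is then at most `2‖wⱼ - wⱼ⁽⁰⁾‖` times a scaled local supremum; weighted by `|vₖⱼ|`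
these add up to `2κ` times the largest local supremum (`signedSum_net_le`). Displacements below `RW
/ 2 ^ K` are paid for by Cauchy–Schwarz and second moments, cheaply once `2√m ≤ 2 ^ K`.

It remains to average a maximum of `cmK` local suprema. Contraction (`contraction_principle`)
compares each with the norm of a Rademacher sum, whose exponential square moment depends only on the
trace and top eigenvalue of `∑ xᵢxᵢᵀ` (`expect_exp_norm_sq_le`). A union bound with optimized
exponent gives `a + ℓ√(2 log(2cmK))` (`expect_iSup_le`).

Finally `sup κ = √c RW RV` exactly (`supPathNorm_eq`), so the two bounds coincide and the ratio
inside `c_m` is `2√m`. -/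

lemma expect_units (f : ℤˣ → ℝ) : 𝔼 e, f e = (f 1 + f (-1)) / 2 := by
  have h : (Finset.univ : Finset ℤˣ) = {1, -1} := by decide
  rw [Fintype.expect_eq_sum_div_card, h, Finset.sum_pair (by decide)]
  simp

lemma expect_fin_succ {n : ℕ} (F : (Fin (n + 1) → ℤˣ) → ℝ) :
    𝔼 σ, F σ = 𝔼 e, 𝔼 τ : Fin n → ℤˣ, F (Fin.cons e τ) := by
  rw [← Finset.expect_product', Finset.univ_product_univ]
  exact (Fintype.expect_equiv (Fin.consEquiv fun _ => ℤˣ) _ _ fun _ => rfl).symm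

/-- A single column of a uniform array of signs is uniform. -/
lemma expect_column {n c : ℕ} (k : Fin c) (F : (Fin n → ℤˣ) → ℝ) :
    𝔼 σ : Fin n → Fin c → ℤˣ, F (fun i => σ i k) = 𝔼 τ, F τ := by
  have h := Fintype.expect_equiv
    ((Equiv.piComm fun (_ : Fin n) (_ : Fin c) => ℤˣ).trans (Equiv.funSplitAt k (Fin n → ℤˣ)))
    (fun σ => F (fun i => σ i k)) (fun p => F p.1) fun _ => rfl
  rw [h, ← Finset.univ_product_univ, Finset.expect_product]
  simp

lemma abs_units_cast (e : ℤˣ) : |((e : ℤ) : ℝ)| = 1 := by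
  rcases Int.units_eq_one_or e with rfl | rfl <;> simp

/-- Jensen's inequality for square roots of averages. -/
lemma expect_sqrt_le {Ω : Type*} [Fintype Ω] [Nonempty Ω] (f : Ω → ℝ) (hf : ∀ ω, 0 ≤ f ω) :
    𝔼 ω, √(f ω) ≤ √(𝔼 ω, f ω) := by
  refine Real.le_sqrt_of_sq_le ?_
  have hc : (0 : ℝ) < Fintype.card Ω := by exact_mod_cast Fintype.card_pos
  have := sq_sum_le_card_mul_sum_sq (s := (Finset.univ : Finset Ω)) (f := fun ω => √(f ω))
  simp only [Real.sq_sqrt (hf _), Finset.card_univ] at this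
  rw [Fintype.expect_eq_sum_div_card, Fintype.expect_eq_sum_div_card, div_pow,
    div_le_div_iff₀ (by positivity) hc]
  nlinarith

/-- The second moment of a Rademacher sum of vectors. -/
lemma expect_norm_sq {E : Type*} [NormedAddCommGroup E] [InnerProductSpace ℝ E] {n : ℕ}
    (a : E) (y : Fin n → E) :
    𝔼 τ : Fin n → ℤˣ, ‖a + ∑ i, ((τ i : ℤ) : ℝ) • y i‖ ^ 2 = ‖a‖ ^ 2 + ∑ i, ‖y i‖ ^ 2 := by
  induction n generalizing a with
  | zero => simp
  | succ n ih =>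
    rw [expect_fin_succ, expect_units, Fin.sum_univ_succ]
    simp only [Fin.sum_univ_succ, Fin.cons_zero, Fin.cons_succ, ← add_assoc, ih]
    -- Averaging over the first sign cancels the cross term.
    have := parallelogram_law_with_norm ℝ a (y 0)
    simp [← sub_eq_add_neg]
    nlinarith

/-! ### The contraction principle -/

/-- Convex monotone functions respect weak majorization of pairs. -/
lemma add_le_add_of_weakMajorization {ψ : ℝ → ℝ} (hψ : ConvexOn ℝ Set.univ ψ)
    (hm : Monotone ψ) {A B P Q : ℝ} (hA : A ≤ max P Q) (hB : B ≤ max P Q) (hs : A + B ≤ P + Q) :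
    ψ A + ψ B ≤ ψ P + ψ Q := by
  wlog hPQ : Q ≤ P generalizing P Q
  · rw [add_comm (ψ P)]
    exact this (by rwa [max_comm]) (by rwa [max_comm]) (by linarith) (le_of_not_ge hPQ)
  rw [max_eq_left hPQ] at hA hB
  rcases le_or_gt B Q with h | hBQ
  · exact add_le_add (hm hA) (hm h)
  rcases le_or_gt A Q with h | hAQ
  · rw [add_comm]; exact add_le_add (hm hB) (hm h)
  have hlt : 0 < P - Q := by linarith
  -- Both points now lie in `(Q, P]`, where `ψ` is below its chord; the factor `P - Q` clears
  -- denominators.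
  have chord : ∀ t, Q < t → t ≤ P → (P - Q) * ψ t ≤ (P - t) * ψ Q + (t - Q) * ψ P := by
    intro t h1 h2
    have := hψ.2 (Set.mem_univ Q) (Set.mem_univ P) 
      (div_nonneg (by linarith) hlt.le : 0 ≤ (P - t) / (P - Q))
      (div_nonneg (by linarith) hlt.le : 0 ≤ (t - Q) / (P - Q)) (by field_simp; ring)
    have e : ((P - t) / (P - Q)) • Q + ((t - Q) / (P - Q)) • P = t := by
      simp only [smul_eq_mul]; field_simp; ring
    rw [e] at this
    simp only [smul_eq_mul] at this
    calc (P - Q) * ψ t ≤ (P - Q) * ((P - t) / (P - Q) * ψ Q + (t - Q) / (P - Q) * ψ P) := by gcongr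
      _ = _ := by field_simp
  have h1 := chord A hAQ hA
  have h2 := chord B hBQ hB
  have h3 := hm hPQ
  refine le_of_mul_le_mul_left ?_ hlt
  nlinarith [mul_nonneg (sub_nonneg.2 hs) (sub_nonneg.2 h3)]

lemma bddAbove_range_of_abs_le {T : Type*} {f : T → ℝ} (h : ∃ C, ∀ t, |f t| ≤ C) :
    BddAbove (Set.range f) := by
  obtain ⟨C, hC⟩ := h
  exact ⟨C, by rintro _ ⟨t, rfl⟩; exact (abs_le.1 (hC t)).2⟩

/-- The pointwise bound `h0` controls the larger of the two suprema and the Lipschitz bound `hl`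
controls their sum: exactly the data of weak majorization. -/
lemma contraction_two_point {T : Type*} [Nonempty T] {ψ : ℝ → ℝ} (hψ : ConvexOn ℝ Set.univ ψ)
    (hm : Monotone ψ) (b f g : T → ℝ) (hb : ∃ C, ∀ t, |b t| ≤ C) (hg : ∃ C, ∀ t, |g t| ≤ C)
    (h0 : ∀ t, |f t| ≤ |g t|) (hl : ∀ s t, |f s - f t| ≤ |g s - g t|) :
    ψ (⨆ t, (b t + f t)) + ψ (⨆ t, (b t - f t)) ≤ ψ (⨆ t, (b t + g t)) + ψ (⨆ t, (b t - g t)) := by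
  obtain ⟨C, hC⟩ := hb
  obtain ⟨D, hD⟩ := hg
  have bdd1 : BddAbove (Set.range fun t => b t + g t) :=
    bddAbove_range_of_abs_le ⟨C + D, fun t => (abs_add_le _ _).trans (add_le_add (hC t) (hD t))⟩
  have bdd2 : BddAbove (Set.range fun t => b t - g t) :=
    bddAbove_range_of_abs_le ⟨C + D, fun t => (abs_sub _ _).trans (add_le_add (hC t) (hD t))⟩
  have key : ∀ t, b t + |g t| ≤ max (⨆ t, (b t + g t)) (⨆ t, (b t - g t)) := by
    intro t
    rcases abs_choice (g t) with h | h <;> rw [h]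
    · exact (le_ciSup bdd1 t).trans (le_max_left _ _)
    · exact (le_ciSup bdd2 t).trans (le_max_right _ _)
  refine add_le_add_of_weakMajorization hψ hm (ciSup_le fun t => ?_)
    (ciSup_le fun t => ?_) ?_
  · exact (by linarith [le_abs_self (f t), h0 t] : b t + f t ≤ b t + |g t|).trans (key t)
  · exact (by linarith [neg_le_abs (f t), h0 t] : b t - f t ≤ b t + |g t|).trans (key t)
  · rw [← le_sub_iff_add_le]
    refine ciSup_le fun s => ?_
    rw [le_sub_iff_add_le, ← le_sub_iff_add_le']
    refine ciSup_le fun t => ?_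
    have h1 := le_ciSup bdd1
    have h2 := le_ciSup bdd2
    have := (le_abs_self _).trans (hl s t)
    rcases abs_choice (g s - g t) with h | h <;> rw [h] at this
    · linarith [h1 s, h2 t]
    · linarith [h1 t, h2 s]

/-- The Ledoux–Talagrand contraction principle for convex monotone functions of a supremum. -/
theorem contraction_principle {T : Type*} [Nonempty T] {ψ : ℝ → ℝ} (hψ : ConvexOn ℝ Set.univ ψ)
    (hm : Monotone ψ) {n : ℕ} (a : T → ℝ) (f g : Fin n → T → ℝ) (ha : ∃ C, ∀ t, |a t| ≤ C)
    (hg : ∀ i, ∃ C, ∀ t, |g i t| ≤ C) (h0 : ∀ i t, |f i t| ≤ |g i t|)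
    (hl : ∀ i s t, |f i s - f i t| ≤ |g i s - g i t|) :
    𝔼 τ : Fin n → ℤˣ, ψ (⨆ t, (a t + ∑ i, ((τ i : ℤ) : ℝ) * f i t)) ≤
      𝔼 τ : Fin n → ℤˣ, ψ (⨆ t, (a t + ∑ i, ((τ i : ℤ) : ℝ) * g i t)) := by
  induction n generalizing a with
  | zero => simp
  | succ n ih =>
    simp only [expect_fin_succ, Fin.sum_univ_succ, Fin.cons_zero, Fin.cons_succ, ← add_assoc]
    obtain ⟨C, hC⟩ := ha
    obtain ⟨D, hD⟩ := hg 0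
    -- With the first sign frozen into the offset, induction replaces the other functions; the
    -- two-point case then replaces `f 0`.
    calc _ ≤ 𝔼 e : ℤˣ, 𝔼 τ : Fin n → ℤˣ, ψ (⨆ t, (a t + ((e : ℤ) : ℝ) * f 0 t
              + ∑ i : Fin n, ((τ i : ℤ) : ℝ) * g i.succ t)) := by
          refine Finset.expect_le_expect fun e _ => ?_
          refine ih _ (fun i => f i.succ) (fun i => g i.succ) ⟨C + D, fun t => ?_⟩
            (fun i => hg _) (fun i => h0 _) (fun i => hl _)
          refine (abs_add_le _ _).trans (add_le_add (hC t) ?_)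
          rw [abs_mul, abs_units_cast, one_mul]
          exact (h0 0 t).trans (hD t)
      _ ≤ _ := by
          rw [Finset.expect_comm, Finset.expect_comm (s := (Finset.univ : Finset ℤˣ))]
          refine Finset.expect_le_expect fun τ _ => ?_
          rw [expect_units, expect_units]
          choose B hB using hg
          have := contraction_two_point hψ hm
            (fun t => a t + ∑ i : Fin n, ((τ i : ℤ) : ℝ) * g i.succ t) (f 0) (g 0)
            ⟨C + ∑ i : Fin n, B i.succ, fun t => ?_⟩ ⟨D, hD⟩ (h0 0) (hl 0)
          · simp only [Units.val_one, Int.cast_one, one_mul, Units.val_neg, Int.cast_neg, neg_mul,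
              add_right_comm _ (f 0 _), add_right_comm _ (g 0 _), add_right_comm _ (-(f 0 _)),
              add_right_comm _ (-(g 0 _)), sub_eq_add_neg] at this ⊢
            linarith
          · refine (abs_add_le _ _).trans (add_le_add (hC t) ?_)
            refine (Finset.abs_sum_le_sum_abs _ _).trans (Finset.sum_le_sum fun i _ => ?_)
            rw [abs_mul, abs_units_cast, one_mul]
            exact hB _ _

section ExpSquare

open MeasureTheory ProbabilityTheory

/-! ### Exponential square moments of Rademacher sums -/

lemma gaussianReal_density_mul_exp (t g : ℝ) :
    gaussianPDFReal 0 1 g * Real.exp (t * g ^ 2 / 2) =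
      (√(2 * Real.pi))⁻¹ * Real.exp (-((1 - t) / 2) * g ^ 2) := by
  rw [gaussianPDFReal, mul_assoc, ← Real.exp_add]
  congr 2
  · simp
  · simp
    ring

lemma integral_exp_sq_gaussianReal {t : ℝ} (ht : t < 1) :
    ∫ g, Real.exp (t * g ^ 2 / 2) ∂(gaussianReal 0 1) = 1 / √(1 - t) := by
  rw [integral_gaussianReal_eq_integral_smul one_ne_zero]
  simp only [smul_eq_mul, gaussianReal_density_mul_exp]
  have h1 : 0 < 1 - t := by linarith
  have hpi := Real.pi_pos
  rw [integral_const_mul, integral_gaussian,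
    show Real.pi / ((1 - t) / 2) = 2 * Real.pi * (1 / (1 - t)) by field_simp,
    Real.sqrt_mul (x := 2 * Real.pi) (by positivity), ← mul_assoc,
    inv_mul_cancel₀ (by positivity), one_mul, Real.sqrt_div zero_le_one, Real.sqrt_one]

/-- A non-integrable function would have integral `0`, contradicting the positive value just
computed. -/
lemma integrable_exp_sq_gaussianReal {t : ℝ} (ht : t < 1) :
    Integrable (fun g => Real.exp (t * g ^ 2 / 2)) (gaussianReal 0 1) := by
  by_contra h
  have h1 := integral_exp_sq_gaussianReal ht
  rw [integral_undef h] at h1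
  have : 0 < 1 / √(1 - t) := by
    have : 0 < 1 - t := by linarith
    positivity
  exact this.ne h1

/-- Apply `1 + u ≤ eᵘ` with `u = t / (1 - t)`. The exponent is linear in `t`, so a product over
eigenvalues sees only their sum, the trace. -/
lemma one_div_sqrt_le_exp {t s : ℝ} (ht : 0 ≤ t) (hts : t ≤ s) (hs : s < 1) :
    1 / √(1 - t) ≤ Real.exp (t / (2 * (1 - s))) := by
  have h1 : 0 < 1 - t := by linarith
  have h2 : 0 < 1 - s := by linarith
  rw [show 1 / √(1 - t) = √(1 / (1 - t)) by simp]
  refine Real.sqrt_le_iff.2 ⟨(Real.exp_pos _).le, ?_⟩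
  rw [← Real.exp_nat_mul]
  calc 1 / (1 - t) = t / (1 - t) + 1 := by field_simp; ring
    _ ≤ Real.exp (t / (1 - t)) := Real.add_one_le_exp _
    _ ≤ Real.exp ((2 : ℕ) * (t / (2 * (1 - s)))) := by
      refine Real.exp_le_exp.2 ?_
      rw [show ((2 : ℕ) : ℝ) * (t / (2 * (1 - s))) = t / (1 - s) by push_cast; field_simp]
      gcongr

lemma expect_exp_sum_le {n : ℕ} (a : Fin n → ℝ) :
    𝔼 τ : Fin n → ℤˣ, Real.exp (∑ i, ((τ i : ℤ) : ℝ) * a i) ≤ Real.exp ((∑ i, a i ^ 2) / 2) := by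
  induction n with
  | zero => simp
  | succ n ih =>
    simp only [expect_fin_succ, Fin.sum_univ_succ, Fin.cons_zero, Fin.cons_succ, Real.exp_add,
      add_div, ← Finset.mul_expect, ← Finset.expect_mul]
    gcongr
    · rw [expect_units]
      have := Real.cosh_le_exp_half_sq (a 0)
      rw [Real.cosh_eq] at this
      simpa using this
    · exact ih _

/-- Exponential square moments of Rademacher sums of the rows of a matrix with orthogonal
columns. -/
lemma expect_exp_sq_le_of_orthogonal {n : ℕ} {ι : Type*} [Fintype ι] (z : Fin n → ι → ℝ)
    (μ : ι → ℝ) (hz : ∀ g : ι → ℝ, ∑ i, (∑ k, g k * z i k) ^ 2 = ∑ k, μ k * g k ^ 2)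
    {θ : ℝ} (hθ : 0 < θ) (hμ : ∀ k, θ * μ k < 1) :
    𝔼 τ : Fin n → ℤˣ, Real.exp (θ * (∑ k, (∑ i, ((τ i : ℤ) : ℝ) * z i k) ^ 2) / 2) ≤
      ∏ k, 1 / √(1 - θ * μ k) := by
  -- A Gaussian average linearizes the square in the exponent, so the signs can be averaged first,
  -- for fixed `g`.
  have lin : ∀ t : ℝ, ∫ g, Real.exp (√θ * t * g) ∂(gaussianReal 0 1)
      = Real.exp (θ * t ^ 2 / 2) := by
    intro t
    have := congrFun (mgf_id_gaussianReal (μ := 0) (v := 1)) (√θ * t)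
    simp only [mgf, id] at this
    rw [this, mul_pow, Real.sq_sqrt hθ.le]
    simp
  have hint : ∀ t : ι → ℝ, Integrable (fun g : ι → ℝ => ∏ k, Real.exp (√θ * t k * g k))
      (Measure.pi fun _ => gaussianReal 0 1) := fun t =>
    Integrable.fintype_prod (f := fun k g => Real.exp (√θ * t k * g))
      fun k => integrable_exp_mul_gaussianReal _
  have e1 : ∀ τ : Fin n → ℤˣ,
      Real.exp (θ * (∑ k, (∑ i, ((τ i : ℤ) : ℝ) * z i k) ^ 2) / 2) =
        ∫ g : ι → ℝ, ∏ k, Real.exp (√θ * (∑ i, ((τ i : ℤ) : ℝ) * z i k) * g k)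
          ∂(Measure.pi fun _ => gaussianReal 0 1) := by
    intro τ
    rw [integral_fintype_prod_eq_prod
      (f := fun k g => Real.exp (√θ * (∑ i, ((τ i : ℤ) : ℝ) * z i k) * g))]
    simp only [lin]
    rw [← Real.exp_sum, Finset.mul_sum, Finset.sum_div]
  simp only [e1]
  rw [Fintype.expect_eq_sum_div_card, ← integral_finsetSum _ fun τ _ => hint _, ← integral_div]
  calc _ ≤ ∫ g : ι → ℝ, ∏ k, Real.exp (θ * μ k * g k ^ 2 / 2)
        ∂(Measure.pi fun _ => gaussianReal 0 1) := by
        refine integral_mono ((integrable_finsetSum _ fun τ _ => hint _).div_const _)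
          (Integrable.fintype_prod (f := fun k g => Real.exp (θ * μ k * g ^ 2 / 2))
            fun k => integrable_exp_sq_gaussianReal (hμ k)) fun g => ?_
        have := expect_exp_sum_le fun i => √θ * ∑ k, g k * z i k
        simp only [mul_pow, Real.sq_sqrt hθ.le, ← Finset.mul_sum, hz] at this
        rw [Fintype.expect_eq_sum_div_card] at this
        simp only [← Real.exp_sum]
        refine (le_of_eq ?_).trans (this.trans (le_of_eq ?_))
        · refine congrArg (· / _) (Finset.sum_congr rfl fun τ _ => congrArg Real.exp ?_)
          simp only [Finset.mul_sum, Finset.sum_mul]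
          rw [Finset.sum_comm]
          exact Finset.sum_congr rfl fun i _ => Finset.sum_congr rfl fun k _ => by ring
        · rw [Finset.mul_sum, Finset.sum_div]
          exact congrArg Real.exp (Finset.sum_congr rfl fun k _ => by ring)
    _ = _ := by
        rw [integral_fintype_prod_eq_prod (f := fun k g => Real.exp (θ * μ k * g ^ 2 / 2))]
        exact Finset.prod_congr rfl fun k _ => integral_exp_sq_gaussianReal (hμ k)

/-- Exponential square moments of the norm of a Rademacher sum of vectors `y i`, in terms of the
trace and the top eigenvalue of `∑ i, y i ⊗ y i`. -/
theorem expect_exp_norm_sq_le {n d : ℕ} (y : Fin n → EuclideanSpace ℝ (Fin d)) {a ℓ θ : ℝ}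
    (ha : ∑ i, ‖y i‖ ^ 2 ≤ a ^ 2) (hℓ : ∀ u, ∑ i, inner ℝ (y i) u ^ 2 ≤ ℓ ^ 2 * ‖u‖ ^ 2)
    (hθ : 0 < θ) (hθℓ : θ * ℓ ^ 2 < 1) :
    𝔼 τ : Fin n → ℤˣ, Real.exp (θ * ‖∑ i, ((τ i : ℤ) : ℝ) • y i‖ ^ 2 / 2) ≤
      Real.exp (θ * a ^ 2 / (2 * (1 - θ * ℓ ^ 2))) := by
  -- In an eigenbasis of `∑ yᵢ ⊗ yᵢ` the coordinate columns are orthogonal; the eigenvalues are at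
  -- most `ℓ ^ 2` and sum to `∑ ‖yᵢ‖ ^ 2`.
  set T : EuclideanSpace ℝ (Fin d) →ₗ[ℝ] EuclideanSpace ℝ (Fin d) :=
    ∑ i, (innerₗ _ (y i)).smulRight (y i) with hTdef
  have hT : ∀ u v, inner ℝ (T u) v = ∑ i, inner ℝ (y i) u * inner ℝ (y i) v := by
    intro u v
    simp [T, LinearMap.sum_apply, sum_inner, inner_smul_left]
  have hsymm : T.IsSymmetric := by
    intro u v
    rw [hT, real_inner_comm, hT]
    exact Finset.sum_congr rfl fun i _ => mul_comm _ _
  set b := hsymm.eigenvectorBasis finrank_euclideanSpace_fin with hb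
  set μ := hsymm.eigenvalues finrank_euclideanSpace_fin with hμdef
  have hTb : ∀ k, T (b k) = μ k • b k := fun k => by
    exact hsymm.apply_eigenvectorBasis finrank_euclideanSpace_fin k
  have hzz : ∀ g : Fin d → ℝ, ∑ i, (∑ k, g k * inner ℝ (y i) (b k)) ^ 2
      = ∑ k, μ k * g k ^ 2 := by
    intro g
    have h1 : ∀ i, ∑ k, g k * inner ℝ (y i) (b k) = inner ℝ (y i) (∑ k, g k • b k) := by
      intro i
      simp [inner_sum, inner_smul_right]
    simp only [h1, sq]
    rw [← hT, map_sum]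
    simp only [map_smul, hTb, smul_smul]
    rw [Orthonormal.inner_sum b.orthonormal]
    refine Finset.sum_congr rfl fun k _ => ?_
    simp
    ring
  have hμ : ∀ k, μ k = ∑ i, inner ℝ (y i) (b k) ^ 2 := by
    intro k
    have := hT (b k) (b k)
    rw [hTb, inner_smul_left, real_inner_self_eq_norm_sq, b.norm_eq_one] at this
    simpa [sq] using this
  have hμ0 : ∀ k, 0 ≤ μ k := fun k => by rw [hμ]; positivity
  have hμℓ : ∀ k, μ k ≤ ℓ ^ 2 := fun k => by
    rw [hμ]; simpa [b.norm_eq_one] using hℓ (b k)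
  have hlt : ∀ k, θ * μ k < 1 := fun k =>
    lt_of_le_of_lt (mul_le_mul_of_nonneg_left (hμℓ k) hθ.le) hθℓ
  have hnorm : ∀ v : EuclideanSpace ℝ (Fin d), ‖v‖ ^ 2 = ∑ k, inner ℝ v (b k) ^ 2 := fun v => by
    rw [← b.sum_sq_norm_inner_left v]; simp
  have htr : ∑ k, μ k ≤ a ^ 2 := by
    refine le_trans (le_of_eq ?_) ha
    simp only [hμ, hnorm]
    exact Finset.sum_comm
  calc _ = 𝔼 τ : Fin n → ℤˣ,
        Real.exp (θ * (∑ k, (∑ i, ((τ i : ℤ) : ℝ) * inner ℝ (y i) (b k)) ^ 2) / 2) := by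
        simp only [hnorm, sum_inner, inner_smul_left]
        simp
    _ ≤ ∏ k, 1 / √(1 - θ * μ k) := expect_exp_sq_le_of_orthogonal _ μ hzz hθ hlt
    _ ≤ ∏ k, Real.exp (θ * μ k / (2 * (1 - θ * ℓ ^ 2))) :=
        Finset.prod_le_prod (fun k _ => by positivity) fun k _ =>
          one_div_sqrt_le_exp (mul_nonneg hθ.le (hμ0 k))
            (mul_le_mul_of_nonneg_left (hμℓ k) hθ.le) hθℓ
    _ ≤ _ := by
        rw [← Real.exp_sum, ← Finset.sum_div, ← Finset.mul_sum]
        have : 0 < 1 - θ * ℓ ^ 2 := by linarith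
        refine Real.exp_le_exp.2 ?_
        gcongr

end ExpSquare

/-! ### Expected maxima -/

/-- The positive part makes the square monotone on all of `ℝ`, as contraction requires, without
changing it at nonnegative suprema. -/
lemma convexOn_posPart_sq : ConvexOn ℝ Set.univ fun y : ℝ => (max y 0) ^ 2 :=
  ((convexOn_id convex_univ).sup (convexOn_const 0 convex_univ)).pow
    (fun _ _ => le_max_right _ _) 2

lemma monotone_posPart_sq : Monotone fun y : ℝ => (max y 0) ^ 2 := fun _ _ h =>
  pow_le_pow_left₀ (le_max_right _ _) (max_le_max_right _ h) 2

lemma convexOn_exp_posPart_sq {θ : ℝ} (hθ : 0 ≤ θ) :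
    ConvexOn ℝ Set.univ fun y : ℝ => Real.exp (θ * (max y 0) ^ 2 / 2) := by
  have h : ConvexOn ℝ Set.univ fun y : ℝ => θ * (max y 0) ^ 2 / 2 := by
    have := convexOn_posPart_sq.smul (by positivity : 0 ≤ θ / 2)
    refine this.congr fun y _ => ?_
    simp only [smul_eq_mul]
    ring
  exact (convexOn_exp.subset (Set.subset_univ _) (Set.OrdConnected.convex (by
    exact (isPreconnected_univ.image _ (by fun_prop)).ordConnected))).comp h
    (Real.exp_monotone.monotoneOn _)

lemma monotone_exp_posPart_sq {θ : ℝ} (hθ : 0 ≤ θ) :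
    Monotone fun y : ℝ => Real.exp (θ * (max y 0) ^ 2 / 2) := fun _ _ h => by
  have := monotone_posPart_sq h
  simp only at this
  refine Real.exp_le_exp.2 ?_
  gcongr

/-- Variables whose exponential squares behave like those of a Gaussian norm of mean `a` and
weak variance `ℓ ^ 2` have expected maximum at most `a + ℓ √(2 log N)`. -/
lemma expect_iSup_le_of_pos {Ω A : Type*} [Fintype Ω] [Nonempty Ω] [Fintype A] [Nonempty A]
    (Z : A → Ω → ℝ) (hZ : ∀ α ω, 0 ≤ Z α ω) {a ℓ C : ℝ} (ha : 0 < a) (hℓ : 0 < ℓ)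
    (hN : 1 < C * Fintype.card A)
    (h : ∀ θ, 0 < θ → θ * ℓ ^ 2 < 1 → ∀ α, 𝔼 ω, Real.exp (θ * (Z α ω) ^ 2 / 2) ≤
      C * Real.exp (θ * a ^ 2 / (2 * (1 - θ * ℓ ^ 2)))) :
    𝔼 ω, ⨆ α, Z α ω ≤ a + ℓ * √(2 * Real.log (C * Fintype.card A)) := by
  set N : ℝ := C * Fintype.card A with hNdef
  have hlog : 0 < Real.log N := Real.log_pos hN
  set b := ℓ * √(2 * Real.log N) with hb
  have hb0 : 0 < b := by positivity
  have hb2 : b ^ 2 = ℓ ^ 2 * (2 * Real.log N) := by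
    rw [hb, mul_pow, Real.sq_sqrt (by positivity)]
  -- This choice gives `1 - θℓ² = a / (a + b)` and `log N = θb(a + b) / 2`, so the exponents add up
  -- to `θ(a + b)² / 2`.
  set θ := b / ((a + b) * ℓ ^ 2) with hθ
  have hθ0 : 0 < θ := by positivity
  have hθℓ : θ * ℓ ^ 2 = b / (a + b) := by rw [hθ]; field_simp
  have hlt : θ * ℓ ^ 2 < 1 := by rw [hθℓ, div_lt_one (by positivity)]; linarith
  set X := 𝔼 ω, ⨆ α, Z α ω with hX
  have hX0 : 0 ≤ X := Finset.expect_nonneg fun ω _ => Real.iSup_nonneg fun α => hZ α ω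
  have hc : (0 : ℝ) < Fintype.card Ω := by exact_mod_cast Fintype.card_pos
  have jensen : Real.exp (θ * X ^ 2 / 2) ≤ 𝔼 ω, Real.exp (θ * (⨆ α, Z α ω) ^ 2 / 2) := by
    have := (convexOn_exp_posPart_sq hθ0.le).map_sum_le (t := (Finset.univ : Finset Ω))
      (w := fun _ => (Fintype.card Ω : ℝ)⁻¹) (p := fun ω => ⨆ α, Z α ω)
      (fun _ _ => by positivity) (by simp [hc.ne']) (fun _ _ => Set.mem_univ _)
    simp only [smul_eq_mul, ← Finset.mul_sum] at this
    rw [← div_eq_inv_mul, ← div_eq_inv_mul, ← Fintype.expect_eq_sum_div_card,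
      ← Fintype.expect_eq_sum_div_card, ← hX, max_eq_left hX0] at this
    refine this.trans (le_of_eq (Finset.expect_congr rfl fun ω _ => ?_))
    rw [max_eq_left (Real.iSup_nonneg fun α => hZ α ω)]
  have union : 𝔼 ω, Real.exp (θ * (⨆ α, Z α ω) ^ 2 / 2) ≤
      N * Real.exp (θ * a ^ 2 / (2 * (1 - θ * ℓ ^ 2))) := by
    calc _ ≤ 𝔼 ω, ∑ α, Real.exp (θ * (Z α ω) ^ 2 / 2) := by
          refine Finset.expect_le_expect fun ω _ => ?_
          obtain ⟨α, hα⟩ := exists_eq_ciSup_of_finite (f := fun α => Z α ω)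
          rw [← hα]
          exact Finset.single_le_sum (f := fun α => Real.exp (θ * (Z α ω) ^ 2 / 2))
            (fun _ _ => (Real.exp_pos _).le) (Finset.mem_univ α)
      _ = ∑ α, 𝔼 ω, Real.exp (θ * (Z α ω) ^ 2 / 2) := Finset.expect_sum_comm _ _ _
      _ ≤ ∑ _α : A, C * Real.exp (θ * a ^ 2 / (2 * (1 - θ * ℓ ^ 2))) :=
          Finset.sum_le_sum fun α _ => h θ hθ0 hlt α
      _ = _ := by simp [hNdef]; ring
  have key := jensen.trans union
  rw [← Real.exp_log (by linarith : 0 < N), ← Real.exp_add, Real.exp_le_exp, hθℓ] at key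
  have e : 1 - b / (a + b) = a / (a + b) := by field_simp; ring
  have e2 : θ * a ^ 2 / (2 * (a / (a + b))) = θ * (a * (a + b)) / 2 := by field_simp
  have e3 : Real.log N = θ * (b * (a + b)) / 2 := by
    have : Real.log N = b ^ 2 / (2 * ℓ ^ 2) := by rw [hb2]; field_simp
    rw [this, hθ]; field_simp
  rw [e, e2, e3] at key
  have : θ * X ^ 2 ≤ θ * (a + b) ^ 2 := by nlinarith
  exact le_of_sq_le_sq (le_of_mul_le_mul_left this hθ0) (by positivity)

/-- Enlarging `a` and `ℓ` by `δ` and letting `δ` shrink admits `a = 0` or `ℓ = 0`; hence the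
hypothesis at all larger parameters. -/
lemma expect_iSup_le {Ω A : Type*} [Fintype Ω] [Nonempty Ω] [Fintype A] [Nonempty A]
    (Z : A → Ω → ℝ) (hZ : ∀ α ω, 0 ≤ Z α ω) {a ℓ C : ℝ} (ha : 0 ≤ a) (hℓ : 0 ≤ ℓ)
    (hN : 1 < C * Fintype.card A)
    (h : ∀ a' ℓ' θ, a ≤ a' → ℓ ≤ ℓ' → 0 < θ → θ * ℓ' ^ 2 < 1 → ∀ α,
      𝔼 ω, Real.exp (θ * (Z α ω) ^ 2 / 2) ≤
        C * Real.exp (θ * a' ^ 2 / (2 * (1 - θ * ℓ' ^ 2)))) :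
    𝔼 ω, ⨆ α, Z α ω ≤ a + ℓ * √(2 * Real.log (C * Fintype.card A)) := by
  set s := √(2 * Real.log (C * Fintype.card A))
  have hs : 0 ≤ s := Real.sqrt_nonneg _
  refine le_of_forall_pos_le_add fun ε hε => ?_
  set δ := ε / (1 + s) with hδ
  have hδ0 : 0 < δ := by positivity
  have := expect_iSup_le_of_pos Z hZ (a := a + δ) (ℓ := ℓ + δ) (by linarith) (by linarith) hN
    fun θ h1 h2 => h _ _ θ (by linarith) (by linarith) h1 h2
  have e : δ * (1 + s) = ε := by rw [hδ]; field_simp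
  refine this.trans (le_of_eq ?_)
  rw [← e]; ring

/-! ### Local suprema of Rademacher sums -/

/-- The supremum over the ball of radius `r` of a signed sum of ridge functions, divided by `r`. -/
noncomputable def scaledSup {n d : ℕ} (x : Fin n → EuclideanSpace ℝ (Fin d)) (φ : Fin n → ℝ → ℝ)
    (r : ℝ) (τ : Fin n → ℤˣ) : ℝ :=
  ⨆ u : Metric.closedBall (0 : EuclideanSpace ℝ (Fin d)) 1,
    |∑ i, ((τ i : ℤ) : ℝ) * (φ i (r * inner ℝ (x i) u) / r)|

section scaledSup

variable {n d : ℕ} (x : Fin n → EuclideanSpace ℝ (Fin d)) (φ : Fin n → ℝ → ℝ) {G : ℝ≥0}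

lemma abs_sub_le_of_lipschitzWith {f : ℝ → ℝ} (hf : LipschitzWith G f) (s t : ℝ) :
    |f s - f t| ≤ G * |s - t| := by
  simpa [Real.dist_eq] using hf.dist_le_mul s t

lemma abs_rescale_sub_le {f : ℝ → ℝ} (hf : LipschitzWith G f) {r : ℝ} (hr : 0 ≤ r)
    (y u v : EuclideanSpace ℝ (Fin d)) :
    |f (r * inner ℝ y u) / r - f (r * inner ℝ y v) / r| ≤
      |inner ℝ ((G : ℝ) • y) u - inner ℝ ((G : ℝ) • y) v| := by
  -- At radius `0` both quotients are `0` by convention.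
  rcases hr.eq_or_lt with rfl | hr
  · simp
  rw [← sub_div, abs_div, abs_of_pos hr, div_le_iff₀ hr]
  refine (abs_sub_le_of_lipschitzWith hf _ _).trans (le_of_eq ?_)
  rw [← mul_sub, abs_mul, abs_of_pos hr, real_inner_smul_left, real_inner_smul_left, ← mul_sub,
    abs_mul, abs_of_nonneg G.coe_nonneg]
  ring

lemma abs_rescale_le {f : ℝ → ℝ} (hf : LipschitzWith G f) (hf0 : f 0 = 0) {r : ℝ} (hr : 0 ≤ r)
    (y u : EuclideanSpace ℝ (Fin d)) :
    |f (r * inner ℝ y u) / r| ≤ |inner ℝ ((G : ℝ) • y) u| := by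
  simpa [hf0] using abs_rescale_sub_le hf hr y u 0

lemma abs_inner_le_norm_of_mem_closedBall (y : EuclideanSpace ℝ (Fin d))
    (u : Metric.closedBall (0 : EuclideanSpace ℝ (Fin d)) 1) :
    |inner ℝ y (u : EuclideanSpace ℝ (Fin d))| ≤ ‖y‖ := by
  refine (abs_real_inner_le_norm _ _).trans (mul_le_of_le_one_right (norm_nonneg _) ?_)
  exact mem_closedBall_zero_iff.1 u.2

lemma scaledSup_nonneg (r : ℝ) (τ : Fin n → ℤˣ) : 0 ≤ scaledSup x φ r τ :=
  Real.iSup_nonneg fun _ => abs_nonneg _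

lemma abs_signedSum_le_mul_scaledSup (hφ : ∀ i, LipschitzWith G (φ i))
    (hφ0 : ∀ i, φ i 0 = 0) {r : ℝ} (hr : 0 ≤ r)
    (τ : Fin n → ℤˣ) {v : EuclideanSpace ℝ (Fin d)}
    (hv : ‖v‖ ≤ r) :
    |∑ i, ((τ i : ℤ) : ℝ) * φ i (inner ℝ (x i) v)| ≤ r * scaledSup x φ r τ := by
  rcases hr.eq_or_lt with rfl | hr'
  · obtain rfl : v = 0 := by simpa using hv
    simp [hφ0]
  have bdd : BddAbove (Set.range fun u : Metric.closedBall (0 : EuclideanSpace ℝ (Fin d)) 1 =>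
      |∑ i, ((τ i : ℤ) : ℝ) * (φ i (r * inner ℝ (x i) u) / r)|) := by
    refine bddAbove_range_of_abs_le ⟨∑ i, ‖(G : ℝ) • x i‖, fun u => ?_⟩
    rw [abs_abs]
    refine (Finset.abs_sum_le_sum_abs _ _).trans (Finset.sum_le_sum fun i _ => ?_)
    rw [abs_mul, abs_units_cast, one_mul]
    exact (abs_rescale_le (hφ i) (hφ0 i) hr _ _).trans (abs_inner_le_norm_of_mem_closedBall _ _)
  have hu : r⁻¹ • v ∈ Metric.closedBall (0 : EuclideanSpace ℝ (Fin d)) 1 := by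
    rw [mem_closedBall_zero_iff, norm_smul, norm_inv, Real.norm_of_nonneg hr,
      inv_mul_le_one₀ hr']
    exact hv
  have := le_ciSup bdd ⟨_, hu⟩
  rw [← div_le_iff₀' hr', ← abs_of_pos hr', ← abs_div, abs_of_pos hr', Finset.sum_div]
  refine le_trans (le_of_eq (congrArg abs (Finset.sum_congr rfl fun i _ => ?_))) this
  rw [real_inner_smul_right, mul_inv_cancel_left₀ hr'.ne', mul_div_assoc]

/-- Symmetrized contraction for the local suprema. -/
lemma expect_scaledSup_le (hφ : ∀ i, LipschitzWith G (φ i))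
    (hφ0 : ∀ i, φ i 0 = 0) {r : ℝ} (hr : 0 ≤ r)
    {ψ : ℝ → ℝ} (hψ : ConvexOn ℝ Set.univ ψ) (hm : Monotone ψ)
    (hψ0 : ∀ t, 0 ≤ ψ t) :
    𝔼 τ, ψ (scaledSup x φ r τ) ≤
      2 * 𝔼 τ : Fin n → ℤˣ, ψ ‖∑ i, ((τ i : ℤ) : ℝ) • ((G : ℝ) • x i)‖ := by
  set B := Metric.closedBall (0 : EuclideanSpace ℝ (Fin d)) 1
  have hB : Nonempty B := ⟨⟨0, by simp [B]⟩⟩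
  have main : ∀ f : Fin n → B → ℝ, (∀ i u, |f i u| ≤ |inner ℝ ((G : ℝ) • x i) u|) →
      (∀ i (u v : B), |f i u - f i v| ≤
        |inner ℝ ((G : ℝ) • x i) u - inner ℝ ((G : ℝ) • x i) v|) →
      𝔼 τ : Fin n → ℤˣ, ψ (⨆ u : B, (0 + ∑ i, ((τ i : ℤ) : ℝ) * f i u)) ≤
        𝔼 τ : Fin n → ℤˣ, ψ ‖∑ i, ((τ i : ℤ) : ℝ) • ((G : ℝ) • x i)‖ := by
    intro f h0 hl
    refine (contraction_principle hψ hm (fun _ : B => 0) f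
      (fun i u => inner ℝ ((G : ℝ) • x i) (u : EuclideanSpace ℝ (Fin d))) ⟨0, by simp⟩
      (fun i => ⟨_, fun u => abs_inner_le_norm_of_mem_closedBall _ u⟩) h0 hl).trans ?_
    refine Finset.expect_le_expect fun τ _ => hm (ciSup_le fun u => ?_)
    have e : 0 + ∑ i, ((τ i : ℤ) : ℝ) * inner ℝ ((G : ℝ) • x i) (u : EuclideanSpace ℝ (Fin d)) =
        inner ℝ (∑ i, ((τ i : ℤ) : ℝ) • ((G : ℝ) • x i)) (u : EuclideanSpace ℝ (Fin d)) := by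
      rw [sum_inner, zero_add]
      exact Finset.sum_congr rfl fun i _ => (real_inner_smul_left _ _ _).symm
    rw [e]
    exact (le_abs_self _).trans (abs_inner_le_norm_of_mem_closedBall _ u)
  set f : Fin n → B → ℝ := fun i u => φ i (r * inner ℝ (x i) u) / r with hf
  have hf0 : ∀ i u, |f i u| ≤ |inner ℝ ((G : ℝ) • x i) (u : EuclideanSpace ℝ (Fin d))| :=
    fun i u => abs_rescale_le (hφ i) (hφ0 i) hr _ _
  have hfl : ∀ i (u v : B), |f i u - f i v| ≤
      |inner ℝ ((G : ℝ) • x i) (u : EuclideanSpace ℝ (Fin d)) - inner ℝ ((G : ℝ) • x i) v| :=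
    fun i u v => abs_rescale_sub_le (hφ i) hr _ _ _
  have h1 := main f hf0 hfl
  have h2 := main (fun i u => -f i u) (fun i u => by rw [abs_neg]; exact hf0 i u)
    (fun i u v => by rw [neg_sub_neg, abs_sub_comm]; exact hfl i u v)
  rw [two_mul]
  refine le_trans ?_ (add_le_add h1 h2)
  rw [← Finset.expect_add_distrib]
  refine Finset.expect_le_expect fun τ _ => ?_
  have bdd : ∀ g : Fin n → B → ℝ, (∀ i u, |g i u| ≤ |inner ℝ ((G : ℝ) • x i)
      (u : EuclideanSpace ℝ (Fin d))|) →
      BddAbove (Set.range fun u : B => 0 + ∑ i, ((τ i : ℤ) : ℝ) * g i u) := by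
    intro g hg
    refine bddAbove_range_of_abs_le ⟨∑ i, ‖(G : ℝ) • x i‖, fun u => ?_⟩
    rw [zero_add]
    refine (Finset.abs_sum_le_sum_abs _ _).trans (Finset.sum_le_sum fun i _ => ?_)
    rw [abs_mul, abs_units_cast, one_mul]
    exact (hg i u).trans (abs_inner_le_norm_of_mem_closedBall _ _)
  have b1 := le_ciSup (bdd f hf0)
  have b2 := le_ciSup (bdd (fun i u => -f i u) fun i u => by rw [abs_neg]; exact hf0 i u)
  -- The absolute value is handled by taking `f` and `-f` together. The resulting factor `2` becomes
  -- the `2` in `log(2mcK)`.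
  have hle : scaledSup x φ r τ ≤ max (⨆ u : B, (0 + ∑ i, ((τ i : ℤ) : ℝ) * f i u))
      (⨆ u : B, (0 + ∑ i, ((τ i : ℤ) : ℝ) * -f i u)) := by
    refine ciSup_le fun u => abs_le'.2 ⟨?_, ?_⟩
    · exact le_max_of_le_left (by simpa using b1 u)
    · refine le_max_of_le_right (le_trans (le_of_eq ?_) (b2 u))
      simp [hf]
  refine (hm hle).trans ?_
  rcases max_choice (⨆ u : B, (0 + ∑ i, ((τ i : ℤ) : ℝ) * f i u))
      (⨆ u : B, (0 + ∑ i, ((τ i : ℤ) : ℝ) * -f i u)) with h | h <;> rw [h]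
  · exact le_add_of_nonneg_right (hψ0 _)
  · exact le_add_of_nonneg_left (hψ0 _)

lemma expect_scaledSup_sq_le (hφ : ∀ i, LipschitzWith G (φ i))
    (hφ0 : ∀ i, φ i 0 = 0) {r : ℝ} (hr : 0 ≤ r) :
    𝔼 τ, scaledSup x φ r τ ^ 2 ≤ 2 * ((G : ℝ) ^ 2 * ∑ i, ‖x i‖ ^ 2) := by
  have := expect_scaledSup_le x φ hφ hφ0 hr convexOn_posPart_sq monotone_posPart_sq
    fun _ => sq_nonneg _
  simp only [max_eq_left (scaledSup_nonneg x φ _ _), max_eq_left (norm_nonneg _)] at this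
  have h2 := expect_norm_sq 0 fun i => (G : ℝ) • x i
  simp only [zero_add] at h2
  rw [h2] at this
  simpa [norm_smul, mul_pow, Finset.mul_sum] using this

lemma expect_exp_scaledSup_sq_le (hφ : ∀ i, LipschitzWith G (φ i))
    (hφ0 : ∀ i, φ i 0 = 0) {r : ℝ} (hr : 0 ≤ r)
    {a ℓ θ : ℝ} (ha : (G : ℝ) ^ 2 * ∑ i, ‖x i‖ ^ 2 ≤ a ^ 2)
    (hℓ : ∀ u, (G : ℝ) ^ 2 * ∑ i, inner ℝ (x i) u ^ 2 ≤ ℓ ^ 2 * ‖u‖ ^ 2)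
    (hθ : 0 < θ) (hθℓ : θ * ℓ ^ 2 < 1) :
    𝔼 τ, Real.exp (θ * scaledSup x φ r τ ^ 2 / 2) ≤
      2 * Real.exp (θ * a ^ 2 / (2 * (1 - θ * ℓ ^ 2))) := by
  have := expect_scaledSup_le x φ hφ hφ0 hr (convexOn_exp_posPart_sq hθ.le)
    (monotone_exp_posPart_sq hθ.le) fun _ => (Real.exp_pos _).le
  simp only [max_eq_left (scaledSup_nonneg x φ _ _), max_eq_left (norm_nonneg _)] at this
  refine this.trans (mul_le_mul_of_nonneg_left ?_ two_pos.le)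
  refine expect_exp_norm_sq_le (fun i => (G : ℝ) • x i) ?_ (fun u => ?_) hθ hθℓ
  · simpa [norm_smul, mul_pow, Finset.mul_sum] using ha
  · simpa [real_inner_smul_left, mul_pow, Finset.mul_sum] using hℓ u

end scaledSup

/-! ### The path-norm -/

lemma sum_mul_le_frobNorm {p q : ℕ} (A B : Matrix (Fin p) (Fin q) ℝ) :
    ∑ i, ∑ j, A i j * B i j ≤ frobNorm A * frobNorm B := by
  unfold frobNorm
  simp only [← Fintype.sum_prod_type']
  exact Real.sum_mul_le_sqrt_mul_sqrt Finset.univ (fun z : Fin p × Fin q => A z.1 z.2) _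

lemma frobNorm_nonneg {p q : ℕ} (A : Matrix (Fin p) (Fin q) ℝ) : 0 ≤ frobNorm A :=
  Real.sqrt_nonneg _

lemma frobNorm_abs {p q : ℕ} (A : Matrix (Fin p) (Fin q) ℝ) :
    frobNorm (Matrix.of fun i j => |A i j|) = frobNorm A := by
  simp [frobNorm]

lemma frobNorm_eq_sqrt_sum_row {p q : ℕ} (A : Matrix (Fin p) (Fin q) ℝ) :
    frobNorm A = √(∑ i, ‖WithLp.toLp 2 (A i)‖ ^ 2) := by
  simp [frobNorm, EuclideanSpace.norm_sq_eq]

lemma norm_row_le_frobNorm {p q : ℕ} (A : Matrix (Fin p) (Fin q) ℝ) (i : Fin p) :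
    ‖WithLp.toLp 2 (A i)‖ ≤ frobNorm A := by
  rw [frobNorm_eq_sqrt_sum_row]
  exact Real.le_sqrt_of_sq_le (Finset.single_le_sum
    (f := fun i => ‖WithLp.toLp 2 (A i)‖ ^ 2) (fun _ _ => sq_nonneg _) (Finset.mem_univ i))

lemma frobNorm_single {p q : ℕ} (i : Fin p) (j : Fin q) (t : ℝ) :
    frobNorm (Matrix.single i j t) = |t| := by
  rw [frobNorm, Finset.sum_eq_single i, Finset.sum_eq_single j]
  · simp [Real.sqrt_sq_eq_abs]
  · intro b _ hb; simp [hb.symm]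
  · simp
  · intro b _ hb; simp [hb.symm]
  · simp

variable {d m c : ℕ} {W₀ W : Matrix (Fin m) (Fin d) ℝ} {V : Matrix (Fin c) (Fin m) ℝ} {RW RV : ℝ}

/-- Cauchy–Schwarz over pairs `(k, j)`: repeating the row norms in `c` rows produces the `√c`. -/
lemma pathNorm_le (hW : W ∈ hiddenBall W₀ RW) (hV : V ∈ topBall c m RV) :
    pathNorm W₀ W V ≤ √c * RW * RV := by
  have h := sum_mul_le_frobNorm (Matrix.of fun k j => |V k j|)
    (Matrix.of fun (_ : Fin c) j => ‖WithLp.toLp 2 (W j - W₀ j)‖)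
  have e : frobNorm (Matrix.of fun (_ : Fin c) j => ‖WithLp.toLp 2 (W j - W₀ j)‖) =
      √c * frobNorm (W - W₀) := by
    rw [frobNorm_eq_sqrt_sum_row (W - W₀), ← Real.sqrt_mul (Nat.cast_nonneg c)]
    simp only [frobNorm, Matrix.of_apply, Finset.sum_const, Finset.card_univ, Fintype.card_fin,
      nsmul_eq_mul]
    rfl
  rw [frobNorm_abs, e, Finset.sum_comm] at h
  have hW' : frobNorm (W - W₀) ≤ RW := hW
  have hV' : frobNorm V ≤ RV := hV
  have h0 := frobNorm_nonneg V
  have h1 := frobNorm_nonneg (W - W₀)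
  calc pathNorm W₀ W V ≤ frobNorm V * (√c * frobNorm (W - W₀)) := h
    _ ≤ RV * (√c * RW) := by gcongr; exact h0.trans hV'
    _ = _ := by ring

lemma bddAbove_pathNormValues : BddAbove (pathNormValues c W₀ RW RV) :=
  ⟨√c * RW * RV, by rintro _ ⟨W, hW, V, hV, rfl⟩; exact pathNorm_le hW hV⟩

/-- Equality in Cauchy–Schwarz: a single neuron carries the whole displacement `RW`, and its
outgoing weights share `RV` evenly over the `c` outputs. -/
lemma exists_pathNorm_eq (hd : 0 < d) (hm : 0 < m) (hc : 0 < c) (hRW : 0 ≤ RW) (hRV : 0 ≤ RV) :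
    √c * RW * RV ∈ pathNormValues c W₀ RW RV := by
  have hc' : (0 : ℝ) < c := by exact_mod_cast hc
  let j₀ : Fin m := ⟨0, hm⟩
  refine ⟨W₀ + Matrix.single j₀ ⟨0, hd⟩ RW, ?_,
    Matrix.of fun _ j => if j = j₀ then RV / √c else 0, ?_, ?_⟩
  · simp [hiddenBall, frobNorm_single, abs_of_nonneg hRW]
  · simp only [topBall, Set.mem_ofPred_eq, frobNorm, Matrix.of_apply]
    refine Real.sqrt_le_iff.2 ⟨hRV, le_of_eq ?_⟩
    simp [ite_pow, div_pow, hc'.le]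
    field_simp
  · rw [pathNorm, Finset.sum_eq_single j₀]
    -- The displaced row, viewed as a `1 × d` matrix, has its norm computed by `frobNorm_single`.
    · have h := frobNorm_eq_sqrt_sum_row (Matrix.single (0 : Fin 1) (⟨0, hd⟩ : Fin d) RW)
      have e : (W₀ + Matrix.single j₀ (⟨0, hd⟩ : Fin d) RW) j₀ - W₀ j₀ =
          Matrix.single (0 : Fin 1) (⟨0, hd⟩ : Fin d) RW 0 := by
        ext l; simp [Matrix.single_apply]
      simp only [frobNorm_single, abs_of_nonneg hRW, Finset.univ_unique, Finset.sum_singleton,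
        Real.sqrt_sq (norm_nonneg _)] at h
      rw [e]
      simp only [Fin.default_eq_zero] at h
      rw [← h]
      have : |RV / √c| = RV / √c := abs_of_nonneg (by positivity)
      simp [this]
      field_simp
      rw [Real.sq_sqrt hc'.le]
      ring
    · intro j _ hj; simp [hj]
    · simp

lemma supPathNorm_eq (hd : 0 < d) (hm : 0 < m) (hc : 0 < c) (hRW : 0 ≤ RW) (hRV : 0 ≤ RV) :
    supPathNorm c W₀ RW RV = √c * RW * RV := by
  have hmem := exists_pathNorm_eq (W₀ := W₀) hd hm hc hRW hRV
  refine le_antisymm (csSup_le ⟨_, hmem⟩ ?_) (le_csSup bddAbove_pathNormValues hmem)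
  rintro _ ⟨W, hW, V, hV, rfl⟩
  exact pathNorm_le hW hV

/-! ### Peeling -/

/-- The smallest available radius still above `t` is at most `2 * t`, unless `t` is below all of
them. This `2` is the price of peeling. -/
lemma exists_dyadic_scale {t R : ℝ} (htR : t ≤ R) (K : ℕ) :
    t ≤ R / 2 ^ K ∨ ∃ l : Fin K, t ≤ R / 2 ^ (l : ℕ) ∧ R / 2 ^ (l : ℕ) ≤ 2 * t := by
  induction K with
  | zero => left; simpa using htR
  | succ K ih =>
    rcases ih with h | ⟨l, hl⟩
    · rcases le_or_gt t (R / 2 ^ (K + 1)) with h' | h'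
      · exact Or.inl h'
      · refine Or.inr ⟨Fin.last K, by simpa using h, ?_⟩
        have : R / 2 ^ K = 2 * (R / 2 ^ (K + 1)) := by field_simp; ring
        simp only [Fin.val_last]
        linarith
    · exact Or.inr ⟨l.castSucc, hl⟩

section peeling

variable {n : ℕ} (γ : ℝ → ℝ) (x : Fin n → EuclideanSpace ℝ (Fin d))

/-- The increment of the activation of a neuron with weights `w` around each sample point. -/
def increment (w : Fin d → ℝ) (i : Fin n) (t : ℝ) : ℝ :=
  γ (w ⬝ᵥ (x i).ofLp + t) - γ (w ⬝ᵥ (x i).ofLp)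

lemma increment_zero (w : Fin d → ℝ) (i : Fin n) : increment γ x w i 0 = 0 := by
  simp [increment]

lemma lipschitzWith_increment {γ} {G : ℝ≥0} (hγ : LipschitzWith G γ) (w : Fin d → ℝ) (i : Fin n) :
    LipschitzWith G (increment γ x w i) := by
  refine LipschitzWith.of_dist_le_mul fun s t => ?_
  simpa [increment, Real.dist_eq] using
    hγ.dist_le_mul (w ⬝ᵥ (x i).ofLp + s) (w ⬝ᵥ (x i).ofLp + t)

/-- The signed sums of the neurons at initialization. -/
def initSums (W₀ : Matrix (Fin m) (Fin d) ℝ) (σ : Fin n → Fin c → ℤˣ) :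
    Matrix (Fin c) (Fin m) ℝ :=
  Matrix.of fun k j => ∑ i, ((σ i k : ℤ) : ℝ) * γ (W₀ j ⬝ᵥ (x i).ofLp)

/-- The scaled local suprema of all neurons at radius `r`. -/
noncomputable def localSups (W₀ : Matrix (Fin m) (Fin d) ℝ) (r : ℝ) (σ : Fin n → Fin c → ℤˣ) :
    Matrix (Fin c) (Fin m) ℝ :=
  Matrix.of fun k j => scaledSup x (increment γ x (W₀ j)) r fun i => σ i k

/-- The largest of the scaled local suprema over `K` dyadic radii below `R`. -/
noncomputable def maxLocalSup (W₀ : Matrix (Fin m) (Fin d) ℝ) (R : ℝ) (K : ℕ)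
    (σ : Fin n → Fin c → ℤˣ) : ℝ :=
  ⨆ α : Fin c × Fin m × Fin K, localSups γ x W₀ (R / 2 ^ (α.2.2 : ℕ)) σ α.1 α.2.1

lemma signedSum_net (W₀ W : Matrix (Fin m) (Fin d) ℝ) (V : Matrix (Fin c) (Fin m) ℝ)
    (σ : Fin n → Fin c → ℤˣ) :
    ∑ i, ∑ k, ((σ i k : ℤ) : ℝ) * net γ W V (x i) k =
      ∑ k, ∑ j, V k j * initSums γ x W₀ σ k j +
      ∑ k, ∑ j, V k j * ∑ i, ((σ i k : ℤ) : ℝ) *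
        increment γ x (W₀ j) i (inner ℝ (x i) (WithLp.toLp 2 (W j - W₀ j))) := by
  have h : ∀ i j, γ (W j ⬝ᵥ (x i).ofLp) = γ (W₀ j ⬝ᵥ (x i).ofLp) +
      increment γ x (W₀ j) i (inner ℝ (x i) (WithLp.toLp 2 (W j - W₀ j))) := by
    intro i j
    rw [increment, EuclideanSpace.inner_eq_star_dotProduct]
    simp [sub_dotProduct]
  simp only [net, Matrix.mulVec, dotProduct, initSums, Matrix.of_apply] at h ⊢
  simp only [h, ← Finset.sum_add_distrib, Finset.mul_sum]
  rw [Finset.sum_comm]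
  refine Finset.sum_congr rfl fun k _ => ?_
  rw [Finset.sum_comm]
  refine Finset.sum_congr rfl fun j _ => ?_
  refine Finset.sum_congr rfl fun i _ => ?_
  ring

lemma localSups_nonneg (W₀ : Matrix (Fin m) (Fin d) ℝ) (r : ℝ) (σ : Fin n → Fin c → ℤˣ)
    (k : Fin c) (j : Fin m) : 0 ≤ localSups γ x W₀ r σ k j :=
  scaledSup_nonneg _ _ _ _

lemma maxLocalSup_nonneg (W₀ : Matrix (Fin m) (Fin d) ℝ) (R : ℝ) (K : ℕ)
    (σ : Fin n → Fin c → ℤˣ) : 0 ≤ maxLocalSup γ x W₀ R K σ :=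
  Real.iSup_nonneg fun _ => localSups_nonneg _ _ _ _ _ _ _

variable {γ} {G : ℝ≥0}

/-- A displacement is either below the last radius or comparable to a dyadic one. Adding both bounds
makes the estimate uniform in `W` apart from a term proportional to the neuron's own displacement.
-/
lemma abs_incrementSum_le (hγ : LipschitzWith G γ) (hRW : 0 ≤ RW) (hW : W ∈ hiddenBall W₀ RW)
    (K : ℕ) (σ : Fin n → Fin c → ℤˣ) (k : Fin c) (j : Fin m) :
    |∑ i, ((σ i k : ℤ) : ℝ) *
        increment γ x (W₀ j) i (inner ℝ (x i) (WithLp.toLp 2 (W j - W₀ j)))| ≤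
      RW / 2 ^ K * localSups γ x W₀ (RW / 2 ^ K) σ k j +
        2 * maxLocalSup γ x W₀ RW K σ * ‖WithLp.toLp 2 (W j - W₀ j)‖ := by
  have hM := maxLocalSup_nonneg γ x W₀ RW K σ
  have hscale : ∀ l : ℕ, 0 ≤ RW / 2 ^ l := fun l => by positivity
  have key : ∀ l : ℕ, ‖WithLp.toLp 2 (W j - W₀ j)‖ ≤ RW / 2 ^ l → _ := fun l =>
    abs_signedSum_le_mul_scaledSup x (increment γ x (W₀ j))
      (lipschitzWith_increment x hγ (W₀ j)) (increment_zero γ x (W₀ j)) (hscale l) (fun i => σ i k)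
  rcases exists_dyadic_scale ((norm_row_le_frobNorm (W - W₀) j).trans hW) K with h | ⟨l, h, h'⟩
  · exact (key K h).trans (le_add_of_nonneg_right (by positivity))
  · refine (key l h).trans (le_add_of_nonneg_of_le
      (mul_nonneg (hscale K) (localSups_nonneg _ _ _ _ _ _ _)) ?_)
    have h1 : localSups γ x W₀ (RW / 2 ^ (l : ℕ)) σ k j ≤ maxLocalSup γ x W₀ RW K σ :=
      le_ciSup (f := fun α : Fin c × Fin m × Fin K =>
        localSups γ x W₀ (RW / 2 ^ (α.2.2 : ℕ)) σ α.1 α.2.1) (Set.finite_range _).bddAbove (k, j, l)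
    calc _ ≤ RW / 2 ^ (l : ℕ) * maxLocalSup γ x W₀ RW K σ :=
          mul_le_mul_of_nonneg_left h1 (hscale _)
      _ ≤ (2 * ‖WithLp.toLp 2 (W j - W₀ j)‖) * maxLocalSup γ x W₀ RW K σ :=
          mul_le_mul_of_nonneg_right h' hM
      _ = _ := by ring

/-- A bound on the signed sums of networks that is uniform over the hypothesis space. -/
lemma signedSum_net_le (hγ : LipschitzWith G γ) (hRW : 0 ≤ RW)
    (hW : W ∈ hiddenBall W₀ RW) (hV : V ∈ topBall c m RV) (K : ℕ) (σ : Fin n → Fin c → ℤˣ) :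
    ∑ i, ∑ k, ((σ i k : ℤ) : ℝ) * net γ W V (x i) k ≤
      RV * frobNorm (initSums γ x W₀ σ) +
        RW / 2 ^ K * RV * frobNorm (localSups γ x W₀ (RW / 2 ^ K) σ) +
        2 * (√c * RW * RV) * maxLocalSup γ x W₀ RW K σ := by
  have hM := maxLocalSup_nonneg γ x W₀ RW K σ
  have hV' : frobNorm V ≤ RV := hV
  have hr : 0 ≤ RW / 2 ^ K := by positivity
  rw [signedSum_net γ x W₀, add_assoc]
  refine add_le_add ((sum_mul_le_frobNorm _ _).trans
    (mul_le_mul_of_nonneg_right hV' (frobNorm_nonneg _))) ?_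
  calc _ ≤ ∑ k, ∑ j, (RW / 2 ^ K * (|V k j| * localSups γ x W₀ (RW / 2 ^ K) σ k j) +
          2 * maxLocalSup γ x W₀ RW K σ * (|V k j| * ‖WithLp.toLp 2 (W j - W₀ j)‖)) := by
        refine Finset.sum_le_sum fun k _ => Finset.sum_le_sum fun j _ => ?_
        refine (le_abs_self _).trans ?_
        rw [abs_mul]
        refine (mul_le_mul_of_nonneg_left (abs_incrementSum_le x hγ hRW hW K σ k j)
          (abs_nonneg _)).trans (le_of_eq ?_)
        ring
    _ = RW / 2 ^ K * ∑ k, ∑ j, |V k j| * localSups γ x W₀ (RW / 2 ^ K) σ k j +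
          2 * maxLocalSup γ x W₀ RW K σ * pathNorm W₀ W V := by
        simp only [Finset.sum_add_distrib, ← Finset.mul_sum]
        rw [pathNorm, Finset.sum_comm (f := fun k j => |V k j| * ‖WithLp.toLp 2 (W j - W₀ j)‖)]
    _ ≤ RW / 2 ^ K * (RV * frobNorm (localSups γ x W₀ (RW / 2 ^ K) σ)) +
          2 * maxLocalSup γ x W₀ RW K σ * (√c * RW * RV) := by
        refine add_le_add (mul_le_mul_of_nonneg_left ?_ hr)
          (mul_le_mul_of_nonneg_left (pathNorm_le hW hV) (by positivity))
        have := sum_mul_le_frobNorm (Matrix.of fun k j => |V k j|)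
          (localSups γ x W₀ (RW / 2 ^ K) σ)
        rw [frobNorm_abs] at this
        exact this.trans (mul_le_mul_of_nonneg_right hV' (frobNorm_nonneg _))
    _ = _ := by ring

lemma bddAbove_signedSums (hγ : LipschitzWith G γ) (hRW : 0 ≤ RW) (σ : Fin n → Fin c → ℤˣ) :
    BddAbove (signedSums (hypothesisSpace c γ W₀ RW RV) x σ) :=
  ⟨_, by
    rintro _ ⟨_, ⟨W, hW, V, hV, rfl⟩, rfl⟩
    -- Any number of scales would do, since the bound does not depend on `W` or `V`.
    exact signedSum_net_le x hγ hRW hW hV 0 σ⟩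

/-! ### Expectations -/

lemma expect_frobNorm_le {Ω : Type*} [Fintype Ω] [Nonempty Ω] {p q : ℕ}
    (A : Ω → Matrix (Fin p) (Fin q) ℝ) :
    𝔼 ω, frobNorm (A ω) ≤ √(∑ i, ∑ j, 𝔼 ω, A ω i j ^ 2) := by
  refine (expect_sqrt_le _ fun ω => by positivity).trans (le_of_eq ?_)
  rw [Finset.expect_sum_comm]
  simp only [Finset.expect_sum_comm]

variable (γ) (W₀)

lemma expect_frobNorm_initSums_le :
    𝔼 σ : Fin n → Fin c → ℤˣ, frobNorm (initSums γ x W₀ σ) ≤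
      √(c * ∑ j, ∑ i, γ ((x i).ofLp ⬝ᵥ W₀ j) ^ 2) := by
  refine (expect_frobNorm_le _).trans (le_of_eq ?_)
  have h : ∀ k j, 𝔼 σ : Fin n → Fin c → ℤˣ, initSums γ x W₀ σ k j ^ 2 =
      ∑ i, γ ((x i).ofLp ⬝ᵥ W₀ j) ^ 2 := by
    intro k j
    have := expect_norm_sq (0 : ℝ) fun i => γ (W₀ j ⬝ᵥ (x i).ofLp)
    simp only [zero_add, norm_zero, smul_eq_mul, Real.norm_eq_abs, sq_abs] at this
    rw [zero_pow two_ne_zero, zero_add] at this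
    simp only [initSums, Matrix.of_apply, dotProduct_comm _ (W₀ j)]
    rw [← this]
    exact expect_column k fun τ => (∑ i, ((τ i : ℤ) : ℝ) * γ (W₀ j ⬝ᵥ (x i).ofLp)) ^ 2
  simp [h]

variable {γ}

lemma expect_frobNorm_localSups_le (hγ : LipschitzWith G γ) {r : ℝ} (hr : 0 ≤ r) :
    𝔼 σ : Fin n → Fin c → ℤˣ, frobNorm (localSups γ x W₀ r σ) ≤
      √2 * √(c * m) * (G * √(∑ i, ‖x i‖ ^ 2)) := by
  have h : ∀ k j, 𝔼 σ : Fin n → Fin c → ℤˣ, localSups γ x W₀ r σ k j ^ 2 ≤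
      2 * ((G : ℝ) ^ 2 * ∑ i, ‖x i‖ ^ 2) := fun k j =>
    (expect_column k fun τ => scaledSup x (increment γ x (W₀ j)) r τ ^ 2).trans_le
      (expect_scaledSup_sq_le x _ (lipschitzWith_increment x hγ (W₀ j))
        (increment_zero γ x (W₀ j)) hr)
  refine (expect_frobNorm_le _).trans (Real.sqrt_le_iff.2 ⟨by positivity, ?_⟩)
  refine (Finset.sum_le_sum fun k _ => Finset.sum_le_sum fun j _ => h k j).trans (le_of_eq ?_)
  rw [mul_pow, mul_pow, mul_pow, Real.sq_sqrt (by positivity), Real.sq_sqrt (by positivity),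
    Real.sq_sqrt (by positivity)]
  simp
  ring

lemma sum_inner_sq_le_specNorm (u : EuclideanSpace ℝ (Fin d)) :
    ∑ i, inner ℝ (x i) u ^ 2 ≤
      specNorm (∑ i, Matrix.vecMulVec (x i).ofLp (x i).ofLp) * ‖u‖ ^ 2 := by
  set A := ∑ i, Matrix.vecMulVec (x i).ofLp (x i).ofLp with hA
  have h1 : inner ℝ u (Matrix.toEuclideanCLM (n := Fin d) (𝕜 := ℝ) A u) =
      ∑ i, inner ℝ (x i) u ^ 2 := by
    rw [hA, map_sum, sum_apply, inner_sum]
    refine Finset.sum_congr rfl fun i _ => ?_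
    rw [EuclideanSpace.inner_eq_star_dotProduct, Matrix.ofLp_toEuclideanCLM,
      Matrix.vecMulVec_mulVec, EuclideanSpace.inner_eq_star_dotProduct]
    simp [sq, dotProduct_comm]
  rw [← h1]
  calc _ ≤ ‖u‖ * (specNorm A * ‖u‖) := (real_inner_le_norm _ _).trans
        (mul_le_mul_of_nonneg_left (ContinuousLinearMap.le_opNorm _ _) (norm_nonneg _))
    _ = _ := by ring

/-- A union bound over `c * m * K` local suprema, with no independence between them needed; each
depends on one column of signs only. -/
lemma expect_maxLocalSup_le (hγ : LipschitzWith G γ) (hRW : 0 ≤ RW) (hm : 0 < m) (hc : 0 < c)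
    {K : ℕ} (hK : 0 < K) :
    𝔼 σ : Fin n → Fin c → ℤˣ, maxLocalSup γ x W₀ RW K σ ≤
      G * √(∑ i, ‖x i‖ ^ 2) +
        G * √(specNorm (∑ i, Matrix.vecMulVec (x i).ofLp (x i).ofLp)) *
          √(2 * Real.log (2 * m * c * K)) := by
  have : Nonempty (Fin c) := ⟨⟨0, hc⟩⟩
  have : Nonempty (Fin m) := ⟨⟨0, hm⟩⟩
  have : Nonempty (Fin K) := ⟨⟨0, hK⟩⟩
  have hspec : 0 ≤ specNorm (∑ i, Matrix.vecMulVec (x i).ofLp (x i).ofLp) := norm_nonneg _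
  have hcard : (2 : ℝ) * Fintype.card (Fin c × Fin m × Fin K) = 2 * m * c * K := by
    simp; ring
  rw [← hcard]
  refine expect_iSup_le _ (fun α σ => localSups_nonneg _ _ _ _ _ _ _) (by positivity)
    (by positivity) ?_ fun a' ℓ' θ ha hℓ hθ hθℓ α => ?_
  · have : (1 : ℝ) ≤ Fintype.card (Fin c × Fin m × Fin K) := by
      exact_mod_cast Fintype.card_pos
    linarith
  · have ha2 : (G : ℝ) ^ 2 * ∑ i, ‖x i‖ ^ 2 ≤ a' ^ 2 := by
      have := pow_le_pow_left₀ (by positivity) ha 2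
      rwa [mul_pow, Real.sq_sqrt (by positivity)] at this
    have hℓ2 := pow_le_pow_left₀ (by positivity) hℓ 2
    rw [mul_pow, Real.sq_sqrt hspec] at hℓ2
    refine (expect_column α.1 fun τ => Real.exp (θ * scaledSup x (increment γ x (W₀ α.2.1))
      (RW / 2 ^ (α.2.2 : ℕ)) τ ^ 2 / 2)).trans_le (expect_exp_scaledSup_sq_le x _
        (lipschitzWith_increment x hγ _) (increment_zero γ x _) (by positivity) ha2
        (fun u => ?_) hθ hθℓ)
    calc _ ≤ (G : ℝ) ^ 2 * (specNorm (∑ i, Matrix.vecMulVec (x i).ofLp (x i).ofLp) * ‖u‖ ^ 2) :=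
          mul_le_mul_of_nonneg_left (sum_inner_sq_le_specNorm x u) (sq_nonneg _)
      _ ≤ _ := by rw [← mul_assoc]; gcongr

/-! ### Assembly of the bound -/

lemma rademacher_eq_expect {Z : Type*} (F : Set (Z → Fin c → ℝ)) (z : Fin n → Z) :
    rademacher F z = 1 / (n : ℝ) * 𝔼 σ : Fin n → Fin c → ℤˣ, sSup (signedSums F z σ) := by
  rw [rademacher, Fintype.expect_eq_sum_div_card]
  simp [← pow_mul, mul_comm]

theorem rademacher_hypothesisSpace_le (hγ : LipschitzWith G γ) (hRW : 0 ≤ RW) (hRV : 0 ≤ RV)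
    (hm : 0 < m) (hc : 0 < c) {K : ℕ} (hK : 0 < K) (hmK : 2 * √m ≤ 2 ^ K) :
    rademacher (hypothesisSpace c γ W₀ RW RV) x ≤
      RV / n * √(c * ∑ j, ∑ i, γ ((x i).ofLp ⬝ᵥ W₀ j) ^ 2) +
        G * (√c * RW * RV) * ((2 + √5) / n * √(∑ i, ‖x i‖ ^ 2) +
          2 * √2 * √(Real.log (2 * m * c * K)) *
            √(specNorm (∑ i, Matrix.vecMulVec (x i).ofLp (x i).ofLp)) / n) := by
  set r := RW / 2 ^ K with hr
  have hr0 : 0 ≤ r := by positivity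
  have hm' : (0 : ℝ) < m := by exact_mod_cast hm
  have hrm : r * √m ≤ RW / 2 := by
    rw [hr, div_mul_eq_mul_div, div_le_div_iff₀ (by positivity) two_pos]
    nlinarith
  set M := √(∑ i, ‖x i‖ ^ 2)
  set L := √(specNorm (∑ i, Matrix.vecMulVec (x i).ofLp (x i).ofLp))
  have hM : 0 ≤ M := Real.sqrt_nonneg _
  -- The residual scale contributes only `√2 / 2`, well within the available `√5`; the `2` in `2 +
  -- √5` comes from the peeled part.
  have h2 : √2 ≤ 2 * √5 := by
    have : √2 ≤ √5 := Real.sqrt_le_sqrt (by norm_num)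
    linarith [Real.sqrt_nonneg 5]
  have hsup : ∀ σ : Fin n → Fin c → ℤˣ, sSup (signedSums (hypothesisSpace c γ W₀ RW RV) x σ) ≤
      RV * frobNorm (initSums γ x W₀ σ) + r * RV * frobNorm (localSups γ x W₀ r σ) +
        2 * (√c * RW * RV) * maxLocalSup γ x W₀ RW K σ := by
    intro σ
    refine csSup_le ⟨_, net γ W₀ 0, ⟨W₀, ?_, 0, ?_, rfl⟩, rfl⟩ ?_
    · simpa [hiddenBall, frobNorm] using hRW
    · simpa [topBall, frobNorm] using hRV
    · rintro _ ⟨_, ⟨W, hW, V, hV, rfl⟩, rfl⟩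
      exact signedSum_net_le x hγ hRW hW hV K σ
  have hE : 𝔼 σ : Fin n → Fin c → ℤˣ, sSup (signedSums (hypothesisSpace c γ W₀ RW RV) x σ) ≤
      RV * √(c * ∑ j, ∑ i, γ ((x i).ofLp ⬝ᵥ W₀ j) ^ 2) +
        r * RV * (√2 * √(c * m) * (G * M)) +
        2 * (√c * RW * RV) * (G * M + G * L * √(2 * Real.log (2 * m * c * K))) := by
    refine (Finset.expect_le_expect fun σ _ => hsup σ).trans ?_
    simp only [Finset.expect_add_distrib, ← Finset.mul_expect]
    exact add_le_add (add_le_add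
      (mul_le_mul_of_nonneg_left (expect_frobNorm_initSums_le W₀ γ x) hRV)
      (mul_le_mul_of_nonneg_left (expect_frobNorm_localSups_le W₀ x hγ hr0) (by positivity)))
      (mul_le_mul_of_nonneg_left (expect_maxLocalSup_le W₀ x hγ hRW hm hc hK) (by positivity))
  have hsmall : r * RV * (√2 * √(c * m) * (G * M)) ≤ √c * RW * RV * (√5 * (G * M)) := by
    rw [Real.sqrt_mul (Nat.cast_nonneg c)]
    calc _ = (r * √m) * √2 * (RV * √c * (G * M)) := by ring
      _ ≤ (RW / 2) * (2 * √5) * (RV * √c * (G * M)) := by gcongr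
      _ = _ := by ring
  rw [rademacher_eq_expect]
  calc _ ≤ 1 / (n : ℝ) * (RV * √(c * ∑ j, ∑ i, γ ((x i).ofLp ⬝ᵥ W₀ j) ^ 2) +
        √c * RW * RV * (√5 * (G * M)) +
        2 * (√c * RW * RV) * (G * M + G * L * √(2 * Real.log (2 * m * c * K)))) := by
        refine mul_le_mul_of_nonneg_left (hE.trans ?_) (by positivity)
        exact add_le_add_left (add_le_add_right hsmall _) _
    _ = _ := by
        rw [Real.sqrt_mul two_pos.le]
        ring

end peeling

/-- Take `K = ⌈log₂(2√m)⌉`, which is the ceiling in `c_m` when `κ = √c RW RV`. The factor `1 + 1 /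
(2 log(2mc))` is at least `1` and is pure slack. -/
lemma widthFactor_ge (hm : 0 < m) (hc : 0 < c) (hRW : 0 < RW) (hRV : 0 < RV) :
    ∃ K : ℕ, 0 < K ∧ 2 * √m ≤ 2 ^ K ∧
      2 * √2 * √(Real.log (2 * m * c * K)) ≤ widthFactor m c RW RV (√c * RW * RV) := by
  have hm1 : (1 : ℝ) ≤ m := by exact_mod_cast hm
  have hc1 : (1 : ℝ) ≤ c := by exact_mod_cast hc
  have hs : 1 ≤ √m := Real.one_le_sqrt.2 hm1
  have hratio : 2 * RW * RV * √(c * m) / (√c * RW * RV) = 2 * √m := by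
    rw [Real.sqrt_mul (by positivity)]
    field_simp
  have hlog : 1 ≤ Real.logb 2 (2 * √m) := by
    rw [Real.le_logb_iff_rpow_le one_lt_two (by positivity)]
    simpa using hs
  have hpos : 0 < ⌈Real.logb 2 (2 * √m)⌉ := Int.ceil_pos.2 (by linarith)
  obtain ⟨K, hK⟩ := Int.eq_ofNat_of_zero_le hpos.le
  have hKpos : 0 < K := by omega
  refine ⟨K, hKpos, ?_, ?_⟩
  · have h := Int.le_ceil (Real.logb 2 (2 * √m))
    rw [hK, Real.logb_le_iff_le_rpow one_lt_two (by positivity)] at h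
    simpa using h
  · rw [widthFactor, hratio, hK]
    have h0 : 0 ≤ Real.log (2 * m * c) := Real.log_nonneg (by nlinarith)
    have h1 : 1 ≤ 1 + 1 / (2 * Real.log (2 * m * c)) := le_add_of_nonneg_right (by positivity)
    push_cast
    exact mul_le_mul_of_nonneg_right (le_mul_of_one_le_right (by positivity) h1)
      (Real.sqrt_nonneg _)

end ShallowNet

theorem theorem1 (n d m c : ℕ) (hn : 0 < n) (hd : 0 < d) (hm : 0 < m) (hc : 0 < c)
    (γ : ℝ → ℝ) (Gγ : ℝ≥0) (hγ : LipschitzWith Gγ γ)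
    (x : Fin n → EuclideanSpace ℝ (Fin d)) (W₀ : Matrix (Fin m) (Fin d) ℝ)
    (RW RV : ℝ) (hRW : 0 ≤ RW) (hRV : 0 ≤ RV) :
    -- all suprema involved are finite
    BddAbove (ShallowNet.pathNormValues c W₀ RW RV) ∧
    (∀ σ : Fin n → Fin c → ℤˣ,
      BddAbove (ShallowNet.signedSums (ShallowNet.hypothesisSpace c γ W₀ RW RV) x σ)) ∧
    -- the bound in terms of the path-norm
    ShallowNet.rademacher (ShallowNet.hypothesisSpace c γ W₀ RW RV) x ≤
      RV / n * √(c * ∑ j, ∑ i, γ ((x i).ofLp ⬝ᵥ W₀ j) ^ 2) +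
        Gγ * ShallowNet.supPathNorm c W₀ RW RV *
          ((2 + √5) / n * √(∑ i, ‖x i‖ ^ 2) +
            ShallowNet.widthFactor m c RW RV (ShallowNet.supPathNorm c W₀ RW RV) *
              √(ShallowNet.specNorm (∑ i, Matrix.vecMulVec (x i).ofLp (x i).ofLp)) / n) ∧
    -- the bound in terms of the Frobenius radii
    ShallowNet.rademacher (ShallowNet.hypothesisSpace c γ W₀ RW RV) x ≤
      RV / n * √(c * ∑ j, ∑ i, γ ((x i).ofLp ⬝ᵥ W₀ j) ^ 2) +
        Gγ * √c * RW * RV *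
          ((2 + √5) / n * √(∑ i, ‖x i‖ ^ 2) +
            ShallowNet.widthFactor m c RW RV (ShallowNet.supPathNorm c W₀ RW RV) *
              √(ShallowNet.specNorm (∑ i, Matrix.vecMulVec (x i).ofLp (x i).ofLp)) / n) := by
  have hsup := ShallowNet.supPathNorm_eq (W₀ := W₀) hd hm hc hRW hRV
  have main : ShallowNet.rademacher (ShallowNet.hypothesisSpace c γ W₀ RW RV) x ≤
      RV / n * √(c * ∑ j, ∑ i, γ ((x i).ofLp ⬝ᵥ W₀ j) ^ 2) +
        Gγ * (√c * RW * RV) * ((2 + √5) / n * √(∑ i, ‖x i‖ ^ 2) +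
          ShallowNet.widthFactor m c RW RV (√c * RW * RV) *
            √(ShallowNet.specNorm (∑ i, Matrix.vecMulVec (x i).ofLp (x i).ofLp)) / n) := by
    by_cases h0 : RW * RV = 0
    -- Everything multiplied by `RW * RV` vanishes, so the value of `widthFactor` at `κ = 0` is
    -- irrelevant and any large `K` serves.
    · obtain ⟨K, hK⟩ := pow_unbounded_of_one_lt (2 * √m) one_lt_two
      refine (ShallowNet.rademacher_hypothesisSpace_le W₀ x hγ hRW hRV hm hc K.succ_pos
        (hK.le.trans (pow_le_pow_right₀ one_le_two K.le_succ))).trans (le_of_eq ?_)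
      simp only [mul_assoc √(c : ℝ), h0, mul_zero, zero_mul]
    · obtain ⟨hW0, hV0⟩ := mul_ne_zero_iff.1 h0
      obtain ⟨K, hK, hmK, hle⟩ := ShallowNet.widthFactor_ge hm hc
        (lt_of_le_of_ne hRW hW0.symm) (lt_of_le_of_ne hRV hV0.symm)
      refine (ShallowNet.rademacher_hypothesisSpace_le W₀ x hγ hRW hRV hm hc hK hmK).trans ?_
      gcongr
  rw [hsup]
  refine ⟨ShallowNet.bddAbove_pathNormValues, ShallowNet.bddAbove_signedSums x hγ hRW, main, ?_⟩
  simpa only [mul_assoc] using main
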